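/- Consider a ring of $n\ge 1$ asynchronous processors $p_0,\dots,p_{n-1}$ (indices modulo $n$). Each $p_i$ owns two safe registers $\mathsf R_a,\mathsf R_b$ (its output registers) with values in $\{0,\dots,K-1\}$, which are written only by $p_i$ and read by $p_i$ and $p_{i+1}$; they are the input registers of $p_{i+1}$. Reads and writes have a duration: a read of a register that is not concurrent with a write of it returns its content, and a read that is concurrent with a write of it returns an arbitrary value in $\{0,\dots,K-1\}$. Let $\phi$ be a positive integer. The processors use two procedures. - $\mathrm{AWrite}(val)$, invoked by $p_i$: read the output register $\mathsf R_a$ into $A$, then $\mathsf R_b$ into $B$; if $A=B=val$ return; otherwise write $val$ to $\mathsf R_a$, then write $val$ to $\mathsf R_b$, and return. - $\mathrm{ARead}(\phi)$, invoked by $p_i$: $\phi$ times in succession, read the input register $\mathsf R_a$ and then the input register $\mathsf R_b$; if all $2\phi$ values obtained are equal, return this value, otherwise return $\perp$. Processor $p_i$ repeats forever: (1) read the output register $\mathsf R_a$ into $x$; (2) $y\leftarrow\mathrm{ARead}(\phi)$; (3) if $y\ne\perp$, $i\neq 0$ and $x\ne y$, set $x\leftarrow y$ (and run the critical section); else if $y\neq\perp$,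 $i=0$ and $y=x$, set $x\leftarrow (x+1)\bmod K$ (and run the critical section); (4) $\mathrm{AWrite}(x)$. An execution is any asynchronous interleaving of steps of the processors, started in any configuration: the contents of registers, the values of local variables and the control points of the processors are arbitrary, except that if the control of $p_i$ starts after the write of $\mathsf R_a$ and before the end of the write of $\mathsf R_b$ in a call $\mathrm{AWrite}(val)$, then its register $\mathsf R_a$ initially holds $val$. The response of an invocation of $\mathrm{ARead}(\phi)$ by $p_i$ is called contaminated if it is a value $v\neq\perp$ that is neither an old nor a new value: at no time during the invocation is $v$ the content of one of the input registers $\mathsf R_a,\mathsf R_b$ of $p_i$, and $v$ is not the argument of any $\mathrm{AWrite}$ of $p_{i-1}$ that is concurrent with the invocation. **Lemma.** If $\phi>2n$, then in every execution no invocation of $\mathrm{ARead}(\phi)$ (made during the execution) has a contaminated response. -/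

import Mathlib

namespace TwoReg

/-- Control points of a processor. `line4`, `line5`, `line6`, `line12` are the lines of the main loop;
the next group lies inside a call of `ARead`, the last group inside a call of `AWrite`.
A read of an input register and a write of an output register both have a duration:
`readingA`, `readingB`, `writingA`, `writingB` are the control points at which such an
operation has been invoked and has not yet responded. -/
inductive PC
  /-- about to read the own output register `R_a` into `x` -/
  | line4
  /-- about to invoke `ARead` -/
  | line5
  /-- in `ARead`: about to invoke a read of the input register `R_a` -/
  | scanA
  /-- in `ARead`: the read of the input register `R_a` is in progress -/
  | readingA
  /-- in `ARead`: about to invoke a read of the input register `R_b` -/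
  | scanB
  /-- in `ARead`: the read of the input register `R_b` is in progress -/
  | readingB
  /-- in `ARead`: all scans done, about to compare the values and to respond -/
  | scanEnd
  /-- `ARead` has responded with `y`; about to update `x` -/
  | line6
  /-- about to invoke `AWrite` with argument `x` -/
  | line12
  /-- in `AWrite`: about to read the own output register `R_a` -/
  | ownA
  /-- in `AWrite`: about to read the own output register `R_b` -/
  | ownB
  /-- in `AWrite`: about to test whether both registers already hold the argument -/
  | test
  /-- in `AWrite`: about to invoke the write of `R_a` -/
  | writeA
  /-- in `AWrite`: the write of `R_a` is in progress -/
  | writingA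
  /-- in `AWrite`: about to invoke the write of `R_b` -/
  | writeB
  /-- in `AWrite`: the write of `R_b` is in progress -/
  | writingB
  deriving DecidableEq

/-- The control point lies inside a call of `ARead`. -/
def PC.InARead (q : PC) : Prop :=
  q = .scanA ∨ q = .readingA ∨ q = .scanB ∨ q = .readingB ∨ q = .scanEnd

/-- The control point lies inside a call of `AWrite`. -/
def PC.InAWrite (q : PC) : Prop :=
  q = .ownA ∨ q = .ownB ∨ q = .test ∨ q = .writeA ∨ q = .writingA ∨ q = .writeB ∨ q = .writingB

/-- Local state of a processor; register values are the elements of `{0, …, K - 1}`, and `none`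
stands for `⊥`. -/
structure Proc (φ K : ℕ) where
  /-- control point -/
  pc : PC
  /-- local variable `x` of the main loop -/
  x : Fin K
  /-- local variable `y` of the main loop -/
  y : Option (Fin K)
  /-- index of the current scan of `ARead` (counted from 0) -/
  k : Fin φ
  /-- local array `A` of `ARead` -/
  A : Fin φ → Fin K
  /-- local array `B` of `ARead` -/
  B : Fin φ → Fin K
  /-- bookkeeping for the safe register semantics: the read in progress has been concurrent with
  a write of the register that is being read -/
  overlap : Bool
  /-- the argument of `AWrite` -/
  val : Fin K
  /-- local variable `A` of `AWrite` -/
  wA : Fin K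
  /-- local variable `B` of `AWrite` -/
  wB : Fin K

/-- Global configuration of a ring of `n` processors: the local states, and the contents of the
output registers `R_a` and `R_b` of each processor. -/
structure Config (n φ K : ℕ) where
  proc : Fin n → Proc φ K
  regA : Fin n → Fin K
  regB : Fin n → Fin K

variable {n φ K : ℕ} [NeZero n]

/-- The previous processor in the ring (cyclically); its output registers are the input registers
of `i`. -/
def prev (i : Fin n) : Fin n := i - 1

/-- Addition of one modulo `K`. -/
def inc (x : Fin K) : Fin K := ⟨(x.val + 1) % K, Nat.mod_lt _ x.pos⟩

/-- The value of `x` after lines 6 to 11 of the main loop of processor `i`. -/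
def nextX (i : Fin n) (x : Fin K) (y : Option (Fin K)) : Fin K :=
  if y ≠ none ∧ i ≠ 0 ∧ y ≠ some x then y.getD x
  else if y ≠ none ∧ i = 0 ∧ y = some x then inc x
  else x

/-- Replace the local state of processor `i`. -/
def Config.upd (c : Config n φ K) (i : Fin n) (p : Proc φ K) : Config n φ K :=
  { c with proc := Function.update c.proc i p }

/-- A write of an output register of `i` is being invoked: a read of this register in progress at
the next processor (which is then at control point `q`) is concurrent with it. -/
def Config.mark (c : Config n φ K) (i : Fin n) (q : PC) : Config n φ K :=
  { c with proc := fun l =>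
      if prev l = i ∧ (c.proc l).pc = q then { c.proc l with overlap := true } else c.proc l }

/-- One step of processor `i`. A processor's reads of its own output registers are never concurrent
with a write of these registers and take a single step. A read of an input register that was
concurrent with a write of this register responds with an arbitrary value, any other read responds
with the content of the register. -/
inductive Step (i : Fin n) (c : Config n φ K) : Config n φ K → Prop
  | line4 (h : (c.proc i).pc = .line4) :
      Step i c (c.upd i { c.proc i with pc := .line5, x := c.regA i })
  | invokeARead (h : (c.proc i).pc = .line5) (k : Fin φ) (hk : k.val = 0) :
      Step i c (c.upd i { c.proc i with pc := .scanA, k := k })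
  | beginReadA (h : (c.proc i).pc = .scanA) :
      Step i c (c.upd i { c.proc i with
        pc := .readingA, overlap := decide ((c.proc (prev i)).pc = .writingA) })
  | endReadA (h : (c.proc i).pc = .readingA) (v : Fin K)
      (hv : (c.proc i).overlap = true ∨ v = c.regA (prev i)) :
      Step i c (c.upd i { c.proc i with
        pc := .scanB, A := Function.update (c.proc i).A (c.proc i).k v })
  | beginReadB (h : (c.proc i).pc = .scanB) :
      Step i c (c.upd i { c.proc i with
        pc := .readingB, overlap := decide ((c.proc (prev i)).pc = .writingB) })
  | endReadBNext (h : (c.proc i).pc = .readingB) (v : Fin K)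
      (hv : (c.proc i).overlap = true ∨ v = c.regB (prev i))
      (k : Fin φ) (hk : k.val = (c.proc i).k.val + 1) :
      Step i c (c.upd i { c.proc i with
        pc := .scanA, B := Function.update (c.proc i).B (c.proc i).k v, k := k })
  | endReadBLast (h : (c.proc i).pc = .readingB) (v : Fin K)
      (hv : (c.proc i).overlap = true ∨ v = c.regB (prev i))
      (hk : (c.proc i).k.val + 1 = φ) :
      Step i c (c.upd i { c.proc i with
        pc := .scanEnd, B := Function.update (c.proc i).B (c.proc i).k v })
  | respondValue (h : (c.proc i).pc = .scanEnd) (v : Fin K)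
      (hv : ∀ l, (c.proc i).A l = v ∧ (c.proc i).B l = v) :
      Step i c (c.upd i { c.proc i with pc := .line6, y := some v })
  | respondBusy (h : (c.proc i).pc = .scanEnd)
      (hv : ¬ ∃ v, ∀ l, (c.proc i).A l = v ∧ (c.proc i).B l = v) :
      Step i c (c.upd i { c.proc i with pc := .line6, y := none })
  | line6 (h : (c.proc i).pc = .line6) :
      Step i c (c.upd i { c.proc i with pc := .line12, x := nextX i (c.proc i).x (c.proc i).y })
  | invokeAWrite (h : (c.proc i).pc = .line12) :
      Step i c (c.upd i { c.proc i with pc := .ownA, val := (c.proc i).x })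
  | ownA (h : (c.proc i).pc = .ownA) :
      Step i c (c.upd i { c.proc i with pc := .ownB, wA := c.regA i })
  | ownB (h : (c.proc i).pc = .ownB) :
      Step i c (c.upd i { c.proc i with pc := .test, wB := c.regB i })
  | testReturn (h : (c.proc i).pc = .test)
      (heq : (c.proc i).wA = (c.proc i).val ∧ (c.proc i).wB = (c.proc i).val) :
      Step i c (c.upd i { c.proc i with pc := .line4 })
  | testWrite (h : (c.proc i).pc = .test)
      (hne : ¬ ((c.proc i).wA = (c.proc i).val ∧ (c.proc i).wB = (c.proc i).val)) :
      Step i c (c.upd i { c.proc i with pc := .writeA })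
  | beginWriteA (h : (c.proc i).pc = .writeA) :
      Step i c ((c.mark i .readingA).upd i { c.proc i with pc := .writingA })
  | endWriteA (h : (c.proc i).pc = .writingA) :
      Step i c { c.upd i { c.proc i with pc := .writeB } with
        regA := Function.update c.regA i (c.proc i).val }
  | beginWriteB (h : (c.proc i).pc = .writeB) :
      Step i c ((c.mark i .readingB).upd i { c.proc i with pc := .writingB })
  | endWriteB (h : (c.proc i).pc = .writingB) :
      Step i c { c.upd i { c.proc i with pc := .line4 } with
        regB := Function.update c.regB i (c.proc i).val }

/-- Initial configurations: registers, local variables and control points are arbitrary, except that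
a processor whose control starts between the two register writes of a call of `AWrite`, or in
the second one, has the argument of this call in `R_a`. -/
def Initial (c : Config n φ K) : Prop :=
  ∀ i, ((c.proc i).pc = .writeB ∨ (c.proc i).pc = .writingB) → c.regA i = (c.proc i).val

/-- Asynchronous executions, without any fairness assumption. Idle steps are allowed, so that finite
executions are included. -/
def IsExecution (c : ℕ → Config n φ K) : Prop :=
  Initial (c 0) ∧ ∀ t, c (t + 1) = c t ∨ ∃ i, Step i (c t) (c (t + 1))

/-- In the execution `c`, processor `i` invokes `ARead` in the step after time `s`, and this invocation
responds with `r` in the step after time `e`. -/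
structure IsARead (c : ℕ → Config n φ K) (i : Fin n) (s e : ℕ) (r : Option (Fin K)) : Prop where
  lt : s < e
  invoked : ((c s).proc i).pc = .line5
  inside : ∀ t, s < t → t ≤ e → ((c t).proc i).pc.InARead
  responded : ((c (e + 1)).proc i).pc = .line6
  response : ((c (e + 1)).proc i).y = r

/-- The response `r` of the `ARead` of `i` between `s` and `e` is contaminated: it is not `⊥`, it is not
an old value, that is, it is at no time of the `ARead` the content of one of the input registers,
and it is not a new value, that is, it is not the argument of an `AWrite` of the previous processor
that is concurrent with the `ARead`. -/
def Contaminated (c : ℕ → Config n φ K) (i : Fin n) (s e : ℕ) (r : Option (Fin K)) : Prop :=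
  ∃ v, r = some v ∧ ∀ t, s < t → t ≤ e →
    v ≠ (c t).regA (prev i) ∧ v ≠ (c t).regB (prev i) ∧
    (((c t).proc (prev i)).pc.InAWrite → v ≠ ((c t).proc (prev i)).val)

end TwoReg

/-! Number the successive contents of a processor's registers: `verB` counts completed writes of
`R_b`, and `verA` is one ahead while an `AWrite` has finished only its first write. If an `ARead` of
`p` is contaminated by `v`, no undisturbed read returned `v`, so all `2φ` reads meet a write. The
two registers are read alternately and written alternately, so the predecessor must advance through
about `φ` versions during this single `ARead` (`churn_of_forall_writing`).

Such activity propagates backwards along the ring. After its first write of `R_b`, a processor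
changes its registers only because of an `ARead` made since its last write
(`IsExecution.exists_replaces`), and the `ARead`s behind successive changes return different values.
Either one of them has only disturbed reads, which gives full activity at the predecessor afresh, or
each contains an undisturbed read, and these see strictly increasing versions (`Clean.lt`). Each
transfer thus loses at most two versions (`Churn.prev`). Once around the ring the loss is `2(n - 1)
< φ`, so `p` itself would write during its own `ARead`, which is absurd (`IsARead.not_churn`). -/

set_option linter.unusedSectionVars false

namespace TwoReg

variable {n φ K : ℕ} [NeZero n]

/-! ### Effect of one step on one processor -/

/-- The control point lies between the two register writes of `AWrite`, or in the second one. -/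
def PC.AfterA (q : PC) : Prop := q = .writeB ∨ q = .writingB

instance : DecidablePred PC.AfterA := fun q => inferInstanceAs (Decidable (q = .writeB ∨ q = .writingB))

/-- Processor `p` is unaffected by the passage from `c` to `c'`, except that a read in progress may
become concurrent with a write. -/
structure Frame (p : Fin n) (c c' : Config n φ K) : Prop where
  regA : c'.regA p = c.regA p
  regB : c'.regB p = c.regB p
  proc : ∃ o, c'.proc p = { c.proc p with overlap := o } ∧
    (o = true → (c.proc p).overlap = true ∨
      ((c.proc p).pc = .readingA ∧ (c'.proc (prev p)).pc = .writingA) ∨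
      ((c.proc p).pc = .readingB ∧ (c'.proc (prev p)).pc = .writingB))

theorem Frame.refl (p : Fin n) (c : Config n φ K) : Frame p c c :=
  ⟨rfl, rfl, (c.proc p).overlap, rfl, Or.inl⟩

theorem frame_upd {i p : Fin n} (hp : p ≠ i) (c : Config n φ K) (P : Proc φ K) :
    Frame p c (c.upd i P) :=
  ⟨rfl, rfl, (c.proc p).overlap, by simp [Config.upd, hp], Or.inl⟩

/-- Only the start of a write reaches another processor, by setting the `overlap` flag of a pending
read. -/
theorem Step.frame {i p : Fin n} {c c' : Config n φ K} (st : Step i c c') (hp : p ≠ i) :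
    Frame p c c' := by
  cases st
  case beginWriteA h =>
    refine ⟨rfl, rfl, ?_⟩
    by_cases hq : prev p = i ∧ (c.proc p).pc = .readingA
    · exact ⟨true, by simp [Config.upd, Config.mark, hp, hq], fun _ => Or.inr (Or.inl
        ⟨hq.2, by simp [Config.upd, hq.1]⟩)⟩
    · exact ⟨(c.proc p).overlap, by simp [Config.upd, Config.mark, hp, hq], Or.inl⟩
  case beginWriteB h =>
    refine ⟨rfl, rfl, ?_⟩
    by_cases hq : prev p = i ∧ (c.proc p).pc = .readingB
    · exact ⟨true, by simp [Config.upd, Config.mark, hp, hq], fun _ => Or.inr (Or.inr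
        ⟨hq.2, by simp [Config.upd, hq.1]⟩)⟩
    · exact ⟨(c.proc p).overlap, by simp [Config.upd, Config.mark, hp, hq], Or.inl⟩
  case endWriteA h =>
    exact ⟨by simp [hp], rfl, (c.proc p).overlap, by simp [Config.upd, hp], Or.inl⟩
  case endWriteB h =>
    exact ⟨rfl, by simp [hp], (c.proc p).overlap, by simp [Config.upd, hp], Or.inl⟩
  all_goals exact frame_upd hp _ _

theorem IsExecution.frame_or_step {c : ℕ → Config n φ K} (hc : IsExecution c) (p : Fin n) (t : ℕ) :
    Frame p (c t) (c (t + 1)) ∨ Step p (c t) (c (t + 1)) := by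
  rcases hc.2 t with h | ⟨i, st⟩
  · rw [h]; exact Or.inl (Frame.refl _ _)
  · by_cases hp : p = i
    · subst hp; exact Or.inr st
    · exact Or.inl (st.frame hp)

/-- How a single step can act on the registers of a processor and on its control inside `AWrite`. -/
theorem IsExecution.write_step {c : ℕ → Config n φ K} (hc : IsExecution c) (p : Fin n) (t : ℕ) :
    (((c t).proc p).pc = .writingA ∧ ((c (t + 1)).proc p).pc = .writeB ∧
      (c (t + 1)).regA p = ((c t).proc p).val ∧ ((c (t + 1)).proc p).val = ((c t).proc p).val ∧
      (c (t + 1)).regB p = (c t).regB p) ∨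
    (((c t).proc p).pc = .writingB ∧ ((c (t + 1)).proc p).pc = .line4 ∧
      (c (t + 1)).regB p = ((c t).proc p).val ∧ (c (t + 1)).regA p = (c t).regA p) ∨
    ((c (t + 1)).regA p = (c t).regA p ∧ (c (t + 1)).regB p = (c t).regB p ∧
      (((c t).proc p).pc = .writingA → ((c (t + 1)).proc p).pc = .writingA) ∧
      (((c t).proc p).pc = .writingB → ((c (t + 1)).proc p).pc = .writingB) ∧
      (((c t).proc p).pc.AfterA ↔ ((c (t + 1)).proc p).pc.AfterA) ∧
      (((c t).proc p).pc.AfterA → ((c (t + 1)).proc p).val = ((c t).proc p).val)) := by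
  rcases hc.frame_or_step p t with h | st
  · obtain ⟨o, ho, -⟩ := h.proc
    refine Or.inr (Or.inr ⟨h.regA, h.regB, ?_⟩)
    rw [ho]
    simp only [PC.AfterA]
    grind
  · generalize c (t + 1) = c' at st
    cases st <;> simp_all [Config.upd, Config.mark, PC.AfterA]

/-! ### Version numbers of register contents -/

variable (c : ℕ → Config n φ K) (p : Fin n)

/-- Version number of the content of `R_b`: the number of completed writes. -/
def verB : ℕ → ℕ
  | 0 => 0
  | t + 1 => verB t +
      if ((c t).proc p).pc = .writingB ∧ ((c (t + 1)).proc p).pc ≠ .writingB then 1 else 0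

/-- Version number of the content of `R_a`: it is ahead of `R_b` by one between the two writes of
a call of `AWrite`. -/
def verA (t : ℕ) : ℕ := verB c p t + if ((c t).proc p).pc.AfterA then 1 else 0

variable {c p}

theorem verB_le_verA (t : ℕ) : verB c p t ≤ verA c p t := Nat.le_add_right _ _

theorem verA_le (t : ℕ) : verA c p t ≤ verB c p t + 1 := by
  unfold verA; split <;> omega

theorem verA_of_afterA {t : ℕ} (h : ((c t).proc p).pc.AfterA) : verA c p t = verB c p t + 1 := by
  simp [verA, h]

theorem verA_of_not_afterA {t : ℕ} (h : ¬ ((c t).proc p).pc.AfterA) : verA c p t = verB c p t := by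
  simp [verA, h]

theorem verB_mono : Monotone (verB c p) :=
  monotone_nat_of_le_succ fun _ => Nat.le_add_right _ _

/-- One step changes the version numbers exactly when a write ends. -/
theorem IsExecution.ver_step (hc : IsExecution c) (t : ℕ) :
    (((c t).proc p).pc = .writingA ∧ ((c (t + 1)).proc p).pc = .writeB ∧
      verA c p (t + 1) = verA c p t + 1 ∧ verB c p (t + 1) = verB c p t ∧
      (c (t + 1)).regB p = (c t).regB p) ∨
    (((c t).proc p).pc = .writingB ∧ ((c (t + 1)).proc p).pc = .line4 ∧
      verA c p (t + 1) = verA c p t ∧ verB c p (t + 1) = verB c p t + 1 ∧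
      (c (t + 1)).regB p = ((c t).proc p).val ∧ (c (t + 1)).regA p = (c t).regA p) ∨
    (verA c p (t + 1) = verA c p t ∧ verB c p (t + 1) = verB c p t ∧
      (c (t + 1)).regA p = (c t).regA p ∧ (c (t + 1)).regB p = (c t).regB p ∧
      (((c t).proc p).pc = .writingA → ((c (t + 1)).proc p).pc = .writingA) ∧
      (((c t).proc p).pc = .writingB → ((c (t + 1)).proc p).pc = .writingB)) := by
  rcases hc.write_step p t with h | h | h
  · left; simp [verA, verB, PC.AfterA, h]
  · right; left; simp [verA, verB, PC.AfterA, h]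
  · right; right
    obtain ⟨h1, h2, h3, h4, h5, -⟩ := h
    have : verB c p (t + 1) = verB c p t := by simp [verB]; exact h4
    exact ⟨by simp [verA, this, h5], this, h1, h2, h3, h4⟩

theorem IsExecution.verA_mono (hc : IsExecution c) : Monotone (verA c p) :=
  monotone_nat_of_le_succ fun t => by
    rcases hc.ver_step (p := p) t with h | h | h <;> omega

theorem IsExecution.regA_eq (hc : IsExecution c) {t t' : ℕ} (h : verA c p t = verA c p t') :
    (c t).regA p = (c t').regA p := by
  wlog htt : t ≤ t' generalizing t t'
  · exact (this h.symm (by omega)).symm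
  induction t', htt using Nat.le_induction with
  | base => rfl
  | succ u hu ih =>
    have h1 := hc.verA_mono (p := p) hu
    rcases hc.ver_step (p := p) u with h' | h' | h'
    · omega
    · rw [ih (by omega), h'.2.2.2.2.2]
    · rw [ih (by omega), h'.2.2.1]

theorem IsExecution.regB_eq (hc : IsExecution c) {t t' : ℕ} (h : verB c p t = verB c p t') :
    (c t).regB p = (c t').regB p := by
  wlog htt : t ≤ t' generalizing t t'
  · exact (this h.symm (by omega)).symm
  induction t', htt using Nat.le_induction with
  | base => rfl
  | succ u hu ih =>
    have h1 := verB_mono (c := c) (p := p) hu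
    rcases hc.ver_step (p := p) u with h' | h' | h'
    · rw [ih (by omega), h'.2.2.2.2]
    · omega
    · rw [ih (by omega), h'.2.2.2.1]

/-- Control leaves `writingA` only by completing the write, which increases the version. -/
theorem IsExecution.verA_lt (hc : IsExecution c) {t t' : ℕ} (htt : t ≤ t')
    (h : ((c t).proc p).pc = .writingA) (h' : ((c t').proc p).pc ≠ .writingA) :
    verA c p t < verA c p t' := by
  have : verA c p t < verA c p t' ∨ ((c t').proc p).pc = .writingA := by
    clear h'
    induction t', htt using Nat.le_induction with
    | base => exact Or.inr h
    | succ u hu ih =>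
      have h1 := hc.verA_mono (p := p) hu
      rcases hc.ver_step (p := p) u with h' | h' | h' <;> grind
  tauto

theorem IsExecution.verB_lt (hc : IsExecution c) {t t' : ℕ} (htt : t ≤ t')
    (h : ((c t).proc p).pc = .writingB) (h' : ((c t').proc p).pc ≠ .writingB) :
    verB c p t < verB c p t' := by
  have : verB c p t < verB c p t' ∨ ((c t').proc p).pc = .writingB := by
    clear h'
    induction t', htt using Nat.le_induction with
    | base => exact Or.inr h
    | succ u hu ih =>
      have h1 := verB_mono (c := c) (p := p) hu
      rcases hc.ver_step (p := p) u with h' | h' | h' <;> grind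
  tauto

/-- Between the two writes of a call of `AWrite`, and during the second, `R_a` holds the argument. -/
theorem IsExecution.regA_eq_val (hc : IsExecution c) (t : ℕ) (h : ((c t).proc p).pc.AfterA) :
    (c t).regA p = ((c t).proc p).val := by
  induction t with
  | zero => exact hc.1 p h
  | succ t ih =>
    rcases hc.write_step p t with h' | h' | h'
    · rw [h'.2.2.1, h'.2.2.2.1]
    · simp [PC.AfterA, h'.2.1] at h
    · rw [h'.1, h'.2.2.2.2.2 (h'.2.2.2.2.1.2 h), ih (h'.2.2.2.2.1.2 h)]

/-- A version of `R_b` beyond that of time `t` is written at the end of a write after time `t`. -/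
theorem exists_end_of_verB_lt {t t' m : ℕ} (h : verB c p t ≤ m) (h' : m < verB c p t') :
    ∃ u, t ≤ u ∧ u < t' ∧ verB c p u = m ∧ ((c u).proc p).pc = .writingB ∧
      verB c p (u + 1) = m + 1 := by
  induction t' with
  | zero => simp [verB] at h'
  | succ u ih =>
    by_cases hu : m < verB c p u
    · obtain ⟨w, h1, h2, h3⟩ := ih hu
      exact ⟨w, h1, by omega, h3⟩
    · have h0 : verB c p (u + 1) = verB c p u + if ((c u).proc p).pc = .writingB ∧
        ((c (u + 1)).proc p).pc ≠ .writingB then 1 else 0 := rfl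
      split at h0
      · next hw =>
        refine ⟨u, ?_, by omega, by omega, hw.1, by omega⟩
        by_contra hlt
        have := verB_mono (c := c) (p := p) (show u + 1 ≤ t by omega)
        omega
      · omega

/-! ### What the reads of an `ARead` observe -/

/-- Progress of an `ARead`. -/
def Proc.rank (P : Proc φ K) : ℕ :=
  4 * P.k.val +
    match P.pc with
    | .readingA => 1
    | .scanB => 2
    | .readingB => 3
    | .scanEnd => 4
    | _ => 0

/-- Since the time `s` and up to the time `t`, in its scan number `l`, processor `p` was reading `R_a`
at a moment at which this register was being written or held `v`. -/
def ObsA (c : ℕ → Config n φ K) (p : Fin n) (s t : ℕ) (l : Fin φ) (v : Fin K) : Prop :=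
  ∃ τ, s < τ ∧ τ ≤ t ∧ ((c τ).proc p).pc = .readingA ∧ ((c τ).proc p).k = l ∧
    (((c τ).proc (prev p)).pc = .writingA ∨ (c τ).regA (prev p) = v)

/-- The analogue of `ObsA` for `R_b`. -/
def ObsB (c : ℕ → Config n φ K) (p : Fin n) (s t : ℕ) (l : Fin φ) (v : Fin K) : Prop :=
  ∃ τ, s < τ ∧ τ ≤ t ∧ ((c τ).proc p).pc = .readingB ∧ ((c τ).proc p).k = l ∧
    (((c τ).proc (prev p)).pc = .writingB ∨ (c τ).regB (prev p) = v)

theorem ObsA.succ {s t : ℕ} {l : Fin φ} {v : Fin K} (h : ObsA c p s t l v) :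
    ObsA c p s (t + 1) l v := by
  obtain ⟨τ, h1, h2, h3⟩ := h; exact ⟨τ, h1, by omega, h3⟩

theorem ObsB.succ {s t : ℕ} {l : Fin φ} {v : Fin K} (h : ObsB c p s t l v) :
    ObsB c p s (t + 1) l v := by
  obtain ⟨τ, h1, h2, h3⟩ := h; exact ⟨τ, h1, by omega, h3⟩

/-- What is known at time `t` during an `ARead` of `p` invoked after time `s`. -/
structure ReadInv (c : ℕ → Config n φ K) (p : Fin n) (s t : ℕ) : Prop where
  obsA : ∀ l : Fin φ, 4 * l.val + 1 < ((c t).proc p).rank → ObsA c p s t l (((c t).proc p).A l)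
  obsB : ∀ l : Fin φ, 4 * l.val + 3 < ((c t).proc p).rank → ObsB c p s t l (((c t).proc p).B l)
  overlapA : ((c t).proc p).pc = .readingA → ((c t).proc p).overlap = true →
    ∀ v, ObsA c p s t ((c t).proc p).k v
  overlapB : ((c t).proc p).pc = .readingB → ((c t).proc p).overlap = true →
    ∀ v, ObsB c p s t ((c t).proc p).k v
  last : ((c t).proc p).pc = .scanEnd → ((c t).proc p).k.val + 1 = φ

/-- An overlapped read may return anything, but its overlap supplies a moment of writing that serves
as an observation for every `v`; any other read returns the content at the moment it ends. -/
theorem ReadInv.succ (hc : IsExecution c) {s t : ℕ} (hst : s < t)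
    (hin : ((c t).proc p).pc.InARead) (hin' : ((c (t + 1)).proc p).pc.InARead)
    (h : ReadInv c p s t) :
    ReadInv c p s (t + 1) ∧ ((c t).proc p).rank ≤ ((c (t + 1)).proc p).rank := by
  obtain ⟨hA, hB, oA, oB, hl⟩ := h
  rcases hc.frame_or_step p t with hf | st
  · obtain ⟨o, ho, ho'⟩ := hf.proc
    have hr : ((c (t + 1)).proc p).rank = ((c t).proc p).rank := by rw [ho]; rfl
    refine ⟨⟨?_, ?_, ?_, ?_, ?_⟩, hr.ge⟩
    · intro l hlt
      rw [hr] at hlt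
      have := (hA l hlt).succ
      rwa [ho]
    · intro l hlt
      rw [hr] at hlt
      have := (hB l hlt).succ
      rwa [ho]
    · intro hpc hov v
      have e1 : ((c (t + 1)).proc p).pc = ((c t).proc p).pc := by rw [ho]
      have e2 : ((c (t + 1)).proc p).k = ((c t).proc p).k := by rw [ho]
      have e3 : o = true := by rw [ho] at hov; exact hov
      rcases ho' e3 with h | h | h
      · rw [e2]; exact (oA (e1 ▸ hpc) h v).succ
      · exact ⟨t + 1, by omega, le_rfl, hpc, rfl, Or.inl h.2⟩
      · rw [e1, h.1] at hpc; cases hpc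
    · intro hpc hov v
      have e1 : ((c (t + 1)).proc p).pc = ((c t).proc p).pc := by rw [ho]
      have e2 : ((c (t + 1)).proc p).k = ((c t).proc p).k := by rw [ho]
      have e3 : o = true := by rw [ho] at hov; exact hov
      rcases ho' e3 with h | h | h
      · rw [e2]; exact (oB (e1 ▸ hpc) h v).succ
      · rw [e1, h.1] at hpc; cases hpc
      · exact ⟨t + 1, by omega, le_rfl, hpc, rfl, Or.inl h.2⟩
    · rw [ho]; exact hl
  · generalize hc' : c (t + 1) = c' at st hin'
    cases st
    case beginReadA h =>
      have hr : ((c (t + 1)).proc p).rank = ((c t).proc p).rank + 1 := by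
        simp [hc', Config.upd, Proc.rank, h]
      rw [← hc']
      refine ⟨⟨fun l hl => ?_, fun l hl => ?_, ?_, ?_, ?_⟩, by omega⟩
      · rw [hr] at hl
        have := (hA l (by simp only [Proc.rank, h] at hl ⊢; omega)).succ
        simpa [hc', Config.upd] using this
      · rw [hr] at hl
        have := (hB l (by simp only [Proc.rank, h] at hl ⊢; omega)).succ
        simpa [hc', Config.upd] using this
      · intro hpc hov v
        refine ⟨t + 1, by omega, le_rfl, hpc, rfl, Or.inl ?_⟩
        simp only [hc', Config.upd, Function.update_self, decide_eq_true_eq] at hov ⊢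
        -- In a ring of one processor the reader is its own predecessor, and then it is not writing.
        by_cases hp : prev p = p
        · rw [hp, h] at hov; cases hov
        · simpa [hp] using hov
      · simp [hc', Config.upd]
      · simp [hc', Config.upd]
    case beginReadB h =>
      have hr : ((c (t + 1)).proc p).rank = ((c t).proc p).rank + 1 := by
        simp [hc', Config.upd, Proc.rank, h]
      rw [← hc']
      refine ⟨⟨fun l hl => ?_, fun l hl => ?_, ?_, ?_, ?_⟩, by omega⟩
      · rw [hr] at hl
        have := (hA l (by simp only [Proc.rank, h] at hl ⊢; omega)).succ
        simpa [hc', Config.upd] using this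
      · rw [hr] at hl
        have := (hB l (by simp only [Proc.rank, h] at hl ⊢; omega)).succ
        simpa [hc', Config.upd] using this
      · simp [hc', Config.upd]
      · intro hpc hov v
        refine ⟨t + 1, by omega, le_rfl, hpc, rfl, Or.inl ?_⟩
        simp only [hc', Config.upd, Function.update_self, decide_eq_true_eq] at hov ⊢
        by_cases hp : prev p = p
        · rw [hp, h] at hov; cases hov
        · simpa [hp] using hov
      · simp [hc', Config.upd]
    case endReadA h v hv =>
      have hr : ((c (t + 1)).proc p).rank = ((c t).proc p).rank + 1 := by
        simp [hc', Config.upd, Proc.rank, h]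
      rw [← hc']
      refine ⟨⟨fun l hl => ?_, fun l hl => ?_, ?_, ?_, ?_⟩, by omega⟩
      · rw [hr] at hl
        by_cases hk : l = ((c t).proc p).k
        · have : ObsA c p s (t + 1) l v := by
            subst hk
            rcases hv with hv | hv
            · exact (oA h hv v).succ
            · exact ⟨t, hst, by omega, h, rfl, Or.inr hv.symm⟩
          simpa [hc', Config.upd, hk] using this
        · have hk' : l.val ≠ ((c t).proc p).k.val := fun h => hk (Fin.ext h)
          have := (hA l (by simp only [Proc.rank, h] at hl ⊢; omega)).succ
          simpa [hc', Config.upd, hk] using this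
      · rw [hr] at hl
        have := (hB l (by simp only [Proc.rank, h] at hl ⊢; omega)).succ
        simpa [hc', Config.upd] using this
      · simp [hc', Config.upd]
      · simp [hc', Config.upd]
      · simp [hc', Config.upd]
    case endReadBNext h v hv k hk =>
      have hr : ((c (t + 1)).proc p).rank = ((c t).proc p).rank + 1 := by
        simp [hc', Config.upd, Proc.rank, h, hk]; ring
      rw [← hc']
      refine ⟨⟨fun l hl => ?_, fun l hl => ?_, ?_, ?_, ?_⟩, by omega⟩
      · rw [hr] at hl
        have := (hA l (by simp only [Proc.rank, h] at hl ⊢; omega)).succ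
        simpa [hc', Config.upd] using this
      · rw [hr] at hl
        by_cases hk : l = ((c t).proc p).k
        · have : ObsB c p s (t + 1) l v := by
            subst hk
            rcases hv with hv | hv
            · exact (oB h hv v).succ
            · exact ⟨t, hst, by omega, h, rfl, Or.inr hv.symm⟩
          simpa [hc', Config.upd, hk] using this
        · have hk' : l.val ≠ ((c t).proc p).k.val := fun h => hk (Fin.ext h)
          have := (hB l (by simp only [Proc.rank, h] at hl ⊢; omega)).succ
          simpa [hc', Config.upd, hk] using this
      · simp [hc', Config.upd]
      · simp [hc', Config.upd]
      · simp [hc', Config.upd]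
    case endReadBLast h v hv hφ =>
      have hr : ((c (t + 1)).proc p).rank = ((c t).proc p).rank + 1 := by
        simp [hc', Config.upd, Proc.rank, h]
      rw [← hc']
      refine ⟨⟨fun l hl => ?_, fun l hl => ?_, ?_, ?_, ?_⟩, by omega⟩
      · rw [hr] at hl
        have := (hA l (by simp only [Proc.rank, h] at hl ⊢; omega)).succ
        simpa [hc', Config.upd] using this
      · rw [hr] at hl
        by_cases hk : l = ((c t).proc p).k
        · have : ObsB c p s (t + 1) l v := by
            subst hk
            rcases hv with hv | hv
            · exact (oB h hv v).succ
            · exact ⟨t, hst, by omega, h, rfl, Or.inr hv.symm⟩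
          simpa [hc', Config.upd, hk] using this
        · have hk' : l.val ≠ ((c t).proc p).k.val := fun h => hk (Fin.ext h)
          have := (hB l (by simp only [Proc.rank, h] at hl ⊢; omega)).succ
          simpa [hc', Config.upd, hk] using this
      · simp [hc', Config.upd]
      · simp [hc', Config.upd]
      · simp [hc', Config.upd, hφ]
    all_goals simp_all [Config.upd, PC.InARead]

theorem ReadInv.init (hc : IsExecution c) {s : ℕ} (h : ((c s).proc p).pc = .line5)
    (h' : ((c (s + 1)).proc p).pc.InARead) : ReadInv c p s (s + 1) := by
  rcases hc.frame_or_step p s with hf | st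
  · obtain ⟨o, ho, -⟩ := hf.proc
    rw [ho] at h'
    simp [h, PC.InARead] at h'
  · generalize hc' : c (s + 1) = c' at st h'
    cases st
    case invokeARead _ k hk =>
      have : ((c (s + 1)).proc p).rank = 0 := by simp [hc', Config.upd, Proc.rank, hk]
      constructor
      · intro l; rw [this]; omega
      · intro l; rw [this]; omega
      all_goals simp [hc', Config.upd]
    all_goals simp_all

theorem IsARead.readInv (hc : IsExecution c) {s e : ℕ} {r : Option (Fin K)}
    (hr : IsARead c p s e r) {t : ℕ} (hst : s < t) (hte : t ≤ e) : ReadInv c p s t := by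
  induction t, hst using Nat.le_induction with
  | base => exact .init hc hr.invoked (hr.inside _ (by omega) hte)
  | succ u hu ih =>
    exact ((ih (by omega)).succ hc hu (hr.inside _ hu (by omega))
      (hr.inside _ (by omega) hte)).1

theorem IsARead.rank_le (hc : IsExecution c) {s e : ℕ} {r : Option (Fin K)}
    (hr : IsARead c p s e r) {t t' : ℕ} (hst : s < t) (htt : t ≤ t') (hte : t' ≤ e) :
    ((c t).proc p).rank ≤ ((c t').proc p).rank := by
  induction t', htt using Nat.le_induction with
  | base => rfl
  | succ u hu ih =>
    exact (ih (by omega)).trans ((hr.readInv hc (by omega) (by omega)).succ hc (by omega)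
      (hr.inside _ (by omega) (by omega)) (hr.inside _ (by omega) hte)).2

/-- An `ARead` with response `v` reads `R_a` and `R_b` alternately, `φ` times each, and at some moment
of each of these reads the register is being written or holds `v`. -/
theorem IsARead.observations (hc : IsExecution c) {s e : ℕ} {v : Fin K}
    (hr : IsARead c p s e (some v)) : ∃ α β : Fin φ → ℕ,
      (∀ k, s < α k ∧ α k < β k ∧ β k ≤ e) ∧ (∀ k l, k < l → β k < α l) ∧
      (∀ k, ((c (α k)).proc (prev p)).pc = .writingA ∨ (c (α k)).regA (prev p) = v) ∧
      (∀ k, ((c (β k)).proc (prev p)).pc = .writingB ∨ (c (β k)).regB (prev p) = v) := by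
  have hinv := hr.readInv hc hr.lt le_rfl
  have hfin : ((c e).proc p).pc = .scanEnd ∧
      ∀ l, ((c e).proc p).A l = v ∧ ((c e).proc p).B l = v := by
    have h1 := hr.responded
    have h2 := hr.response
    have h3 := hr.inside e hr.lt le_rfl
    rcases hc.frame_or_step p e with hf | st
    · obtain ⟨o, ho, -⟩ := hf.proc
      rw [ho] at h1
      simp [show ((c e).proc p).pc = .line6 from h1, PC.InARead] at h3
    · generalize c (e + 1) = c' at st h1 h2
      cases st <;> simp_all [Config.upd, PC.InARead]
  have hrank : ((c e).proc p).rank = 4 * φ := by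
    have := hinv.last hfin.1
    simp only [Proc.rank, hfin.1]; omega
  have hα : ∀ l, ObsA c p s e l v := fun l => by
    have := hinv.obsA l (by have := l.2; omega)
    rwa [(hfin.2 l).1] at this
  have hβ : ∀ l, ObsB c p s e l v := fun l => by
    have := hinv.obsB l (by have := l.2; omega)
    rwa [(hfin.2 l).2] at this
  choose α a1 a2 a3 a4 a5 using hα
  choose β b1 b2 b3 b4 b5 using hβ
  -- The rank identifies the read in progress and never decreases during the `ARead`, so comparing
  -- ranks orders the observation times.
  have ra : ∀ l, ((c (α l)).proc p).rank = 4 * l.val + 1 := fun l => by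
    simp [Proc.rank, a3, a4]
  have rb : ∀ l, ((c (β l)).proc p).rank = 4 * l.val + 3 := fun l => by
    simp [Proc.rank, b3, b4]
  refine ⟨α, β, fun k => ⟨a1 k, ?_, b2 k⟩, fun k l hkl => ?_, a5, b5⟩
  · by_contra! hlt
    have := hr.rank_le hc (b1 k) hlt (a2 k)
    rw [ra, rb] at this; omega
  · by_contra! hlt
    have := hr.rank_le hc (a1 l) hlt (b2 k)
    rw [ra, rb] at this
    have : k.val < l.val := hkl
    omega

/-! ### Why a processor changes its registers -/

/-- Since the last write of `R_b` before time `t`, an `ARead` of `p` has made `p` replace the register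
value `r` by a different value `z`. -/
def Replaces (c : ℕ → Config n φ K) (p : Fin n) (t : ℕ) (z r : Fin K) : Prop :=
  ∃ s e v, verB c p s = verB c p t ∧ e < t ∧ IsARead c p s e (some v) ∧ z ≠ r ∧
    (p ≠ 0 → v = z) ∧ (p = 0 → v = r)

theorem Replaces.succ {t : ℕ} {z r : Fin K} (hv : verB c p (t + 1) = verB c p t)
    (h : Replaces c p t z r) : Replaces c p (t + 1) z r := by
  obtain ⟨s, e, v, h1, h2, h3⟩ := h
  exact ⟨s, e, v, by omega, by omega, h3⟩

/-- An invariant of the main loop, valid after the first write of `R_b`. -/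
def LoopInv (c : ℕ → Config n φ K) (p : Fin n) (t : ℕ) : Prop :=
  match ((c t).proc p).pc with
  | .line4 => (c t).regB p = (c t).regA p
  | .line5 => (c t).regB p = (c t).regA p ∧ ((c t).proc p).x = (c t).regA p
  | .line6 => (c t).regB p = (c t).regA p ∧ ((c t).proc p).x = (c t).regA p ∧
      ∀ v, ((c t).proc p).y = some v →
        ∃ s e, verB c p s = verB c p t ∧ e < t ∧ IsARead c p s e (some v)
  | .line12 => (c t).regB p = (c t).regA p ∧
      (((c t).proc p).x = (c t).regA p ∨ Replaces c p t ((c t).proc p).x ((c t).regA p))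
  | .ownA => (c t).regB p = (c t).regA p ∧
      (((c t).proc p).val = (c t).regA p ∨ Replaces c p t ((c t).proc p).val ((c t).regA p))
  | .ownB => (c t).regB p = (c t).regA p ∧
      (((c t).proc p).val = (c t).regA p ∨ Replaces c p t ((c t).proc p).val ((c t).regA p)) ∧
      ((c t).proc p).wA = (c t).regA p
  | .test => (c t).regB p = (c t).regA p ∧
      (((c t).proc p).val = (c t).regA p ∨ Replaces c p t ((c t).proc p).val ((c t).regA p)) ∧
      ((c t).proc p).wA = (c t).regA p ∧ ((c t).proc p).wB = (c t).regA p
  | .writeA => (c t).regB p = (c t).regA p ∧ Replaces c p t ((c t).proc p).val ((c t).regA p)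
  | .writingA => (c t).regB p = (c t).regA p ∧ Replaces c p t ((c t).proc p).val ((c t).regA p)
  | .writeB => Replaces c p t ((c t).proc p).val ((c t).regB p)
  | .writingB => Replaces c p t ((c t).proc p).val ((c t).regB p)
  | _ => (c t).regB p = (c t).regA p ∧ ((c t).proc p).x = (c t).regA p ∧
      ∃ s < t, verB c p s = verB c p t ∧ ((c s).proc p).pc = .line5 ∧
        ∀ u, s < u → u ≤ t → ((c u).proc p).pc.InARead

theorem inside_succ {s t : ℕ} (h : ∀ u, s < u → u ≤ t → ((c u).proc p).pc.InARead)
    (h' : ((c (t + 1)).proc p).pc.InARead) :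
    ∀ u, s < u → u ≤ t + 1 → ((c u).proc p).pc.InARead := fun u hu hut => by
  rcases Nat.lt_or_ge t u with h1 | h1
  · obtain rfl : u = t + 1 := by omega
    exact h'
  · exact h u hu h1

theorem LoopInv.succ (hc : IsExecution c) {t : ℕ} (hv : verB c p (t + 1) = verB c p t)
    (h : LoopInv c p t) : LoopInv c p (t + 1) := by
  rcases hc.frame_or_step p t with hf | st
  · obtain ⟨o, ho, -⟩ := hf.proc
    have hpc : ((c (t + 1)).proc p).pc = ((c t).proc p).pc := by rw [ho]
    unfold LoopInv at h ⊢
    rw [ho, hf.regA, hf.regB, hv]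
    have hin := fun s h h' => @inside_succ n φ K _ c p s t h h'
    rw [hpc] at hin
    cases hq : ((c t).proc p).pc <;> simp only [hq] at h hin ⊢
    case scanA | readingA | scanB | readingB | scanEnd =>
      obtain ⟨h1, h2, s, h3, h4, h5, h6⟩ := h
      exact ⟨h1, h2, s, by omega, h4, h5, hin s h6 (by simp [PC.InARead])⟩
    case line6 =>
      obtain ⟨h1, h2, h3⟩ := h
      refine ⟨h1, h2, fun v hv => ?_⟩
      obtain ⟨s, e, h4, h5, h6⟩ := h3 v hv
      exact ⟨s, e, h4, by omega, h6⟩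
    all_goals
      have hR := fun z r => @Replaces.succ n φ K _ c p t z r hv
      grind
  · have hin := fun s h h' => @inside_succ n φ K _ c p s t h h'
    have hR := fun z r => @Replaces.succ n φ K _ c p t z r hv
    have hAv := hc.regA_eq_val (p := p) t
    generalize hc' : c (t + 1) = c' at st hin
    cases st
    case respondValue hq v hv' =>
      simp only [LoopInv, hq] at h
      obtain ⟨h1, h2, s, h3, h4, h5, h6⟩ := h
      simp only [LoopInv, hc', Config.upd, Function.update_self, hv]
      refine ⟨h1, h2, fun w hw => ⟨s, t, h4, by omega, h3, h5, h6, ?_, ?_⟩⟩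
      · simp [hc', Config.upd]
      · simpa [hc', Config.upd] using hw
    case line6 hq =>
      simp only [LoopInv, hq] at h
      obtain ⟨h1, h2, h3⟩ := h
      simp only [LoopInv, hc', Config.upd, Function.update_self]
      refine ⟨h1, ?_⟩
      -- For `K = 1` the increment by processor 0 changes nothing, so the split is on the resulting
      -- value.
      by_cases hx : nextX p ((c t).proc p).x ((c t).proc p).y = (c t).regA p
      · exact Or.inl hx
      · right
        cases hy : ((c t).proc p).y with
        | none => simp [nextX, hy, h2] at hx
        | some v =>
          obtain ⟨s, e, h4, h5, h6⟩ := h3 v hy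
          rw [hy] at hx
          refine ⟨s, e, v, by omega, by omega, h6, hx, fun hp => ?_, fun hp => ?_⟩
          · by_cases hvx : v = ((c t).proc p).x
            · simp [nextX, hp, hvx, h2] at hx
            · simp [nextX, hp, hvx]
          · by_contra hvx
            subst hp
            simp [nextX, h2, hvx] at hx
    case invokeARead hq k hk =>
      simp only [LoopInv, hq] at h
      simp only [LoopInv, hc', Config.upd, Function.update_self, hv]
      refine ⟨h.1, h.2, t, by omega, rfl, hq, fun u h1 h2 => ?_⟩
      obtain rfl : u = t + 1 := by omega
      simp [hc', Config.upd, PC.InARead]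
    case endWriteB hq =>
      simp [verB, hq, hc', Config.upd] at hv
    case beginReadA hq | beginReadB hq | endReadA hq _ _ | endReadBNext hq _ _ _ _ |
        endReadBLast hq _ _ _ =>
      simp only [LoopInv, hq] at h
      obtain ⟨h1, h2, s, h3, h4, h5, h6⟩ := h
      simp only [LoopInv, hc', Config.upd, Function.update_self, hv]
      exact ⟨h1, h2, s, by omega, h4, h5, hin s h6 (by simp [Config.upd, PC.InARead])⟩
    all_goals
      next hq =>
        simp only [LoopInv, hq] at h
        simp only [LoopInv, hc', Config.upd, Config.mark, Function.update_self]
        grind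

theorem IsExecution.loopInv (hc : IsExecution c) {t : ℕ} (h : 1 ≤ verB c p t) :
    LoopInv c p t := by
  induction t with
  | zero => simp [verB] at h
  | succ t ih =>
    rcases hc.ver_step (p := p) t with h' | h' | h'
    · exact (ih (by omega)).succ hc h'.2.2.2.1
    -- The end of a write of `R_b` establishes the invariant: both registers now hold the argument.
    · simp only [LoopInv, h'.2.1]
      rw [h'.2.2.2.2.1, h'.2.2.2.2.2, hc.regA_eq_val t (Or.inr h'.1)]
    · exact (ih (by omega)).succ hc h'.2.1

/-- From the second version on, equal versions of `R_a` and `R_b` have equal contents. -/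
theorem IsExecution.regA_eq_regB (hc : IsExecution c) {t t' : ℕ} (h : verA c p t = verB c p t')
    (h1 : 1 ≤ verB c p t') : (c t).regA p = (c t').regB p := by
  by_cases hw : ((c t).proc p).pc.AfterA
  · rw [verA_of_afterA hw] at h
    -- The same `AWrite` completes its second write before `t'`, putting the content of `R_a` into
    -- `R_b`.
    obtain ⟨u, -, -, h3, h4, h5⟩ := exists_end_of_verB_lt (p := p) (c := c) le_rfl
      (show verB c p t < verB c p t' by omega)
    have h6 : ((c u).proc p).pc.AfterA := Or.inr h4
    rcases hc.ver_step (p := p) u with h' | h' | h'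
    · omega
    · rw [hc.regB_eq (show verB c p t' = verB c p (u + 1) by omega), h'.2.2.2.2.1,
        ← hc.regA_eq_val u h6]
      exact hc.regA_eq (by rw [verA_of_afterA hw, verA_of_afterA h6, h3])
    · omega
  · rw [verA_of_not_afterA hw] at h
    rw [← hc.regB_eq h]
    have := hc.loopInv (p := p) (t := t) (by omega)
    unfold LoopInv at this
    unfold PC.AfterA at hw
    grind

/-- Every version of `R_b` between those of `t₀` and `t₁` (both excluded) is followed by an `ARead`
which made `p` replace it. -/
theorem IsExecution.exists_replaces (hc : IsExecution c) {t₀ t₁ m : ℕ} (h0 : verB c p t₀ < m)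
    (h1 : m < verA c p t₁) : ∃ t ≤ t₁, verB c p t = m ∧ ((c t).proc p).pc.AfterA ∧
      Replaces c p t ((c t).regA p) ((c t).regB p) := by
  obtain ⟨t, ht, hm, hw⟩ : ∃ t ≤ t₁, verB c p t = m ∧ ((c t).proc p).pc.AfterA := by
    -- Either version `m` of `R_b` has been overwritten by `t₁`, and the end of that write is taken,
    -- or `p` is between its two writes at `t₁`.
    by_cases hlt : m < verB c p t₁
    · obtain ⟨u, -, h2, h3, h4, -⟩ :=
        exists_end_of_verB_lt (c := c) (p := p) (t := 0) (m := m) (by simp [verB]) hlt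
      exact ⟨u, h2.le, h3, Or.inr h4⟩
    · refine ⟨t₁, le_rfl, ?_, ?_⟩
      · have := verA_le (c := c) (p := p) t₁
        omega
      · by_contra hw
        rw [verA_of_not_afterA hw] at h1
        omega
  refine ⟨t, ht, hm, hw, ?_⟩
  have := hc.loopInv (p := p) (t := t) (by omega)
  rw [hc.regA_eq_val t hw]
  rcases hw with hw | hw <;> simpa only [LoopInv, hw] using this

/-! ### Many writes or an undisturbed read -/

/-- Between `s` and `e`, processor `p` ends at least `φ - 1 - 2 * d` passes of its main loop that begin
after a write of `R_b` and change the content of the registers. -/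
def Churn (c : ℕ → Config n φ K) (p : Fin n) (s e d : ℕ) : Prop :=
  ∃ t t', s < t ∧ t' ≤ e ∧ verB c p t + φ ≤ verA c p t' + 2 * d

theorem Churn.mono {s s' e e' d d' : ℕ} (h : Churn c p s e d) (hs : s' ≤ s) (he : e ≤ e')
    (hd : d ≤ d') : Churn c p s' e' d' := by
  obtain ⟨t, t', h1, h2, h3⟩ := h
  exact ⟨t, t', by omega, by omega, by omega⟩

/-- After `s` and up to `e`, one of the registers of `p`, in its version `m`, is read as `v` without
being written at that moment `τ`. At the moment `σ` of the companion read in the same scan, the other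
register is being written or holds `v` as well. -/
def Clean (c : ℕ → Config n φ K) (p : Fin n) (s e m : ℕ) (v : Fin K) : Prop :=
  ∃ τ σ, s < τ ∧ τ ≤ e ∧ s < σ ∧ σ ≤ e ∧
    ((τ ≤ σ ∧ ((c τ).proc p).pc ≠ .writingA ∧ (c τ).regA p = v ∧ verA c p τ = m ∧
        (((c σ).proc p).pc = .writingB ∨ (c σ).regB p = v)) ∨
      (σ ≤ τ ∧ ((c τ).proc p).pc ≠ .writingB ∧ (c τ).regB p = v ∧ verB c p τ = m ∧
        (((c σ).proc p).pc = .writingA ∨ (c σ).regA p = v)))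

/-- Turns a difference of clean versions into the inequality required by `Churn`. -/
theorem Clean.exists_time {s e m : ℕ} {v : Fin K} (h : Clean c p s e m v) :
    ∃ τ, s < τ ∧ τ ≤ e ∧ verB c p τ ≤ m ∧ m ≤ verA c p τ := by
  obtain ⟨τ, σ, h1, h2, -, -, h⟩ := h
  have := verB_le_verA (c := c) (p := p) τ
  exact ⟨τ, h1, h2, by omega, by omega⟩

/-- If each read of an `ARead` is concurrent with a write, then there are many writes. -/
theorem churn_of_forall_writing (hc : IsExecution c) (hφ : 0 < φ) {s e : ℕ} (α β : Fin φ → ℕ)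
    (h1 : ∀ k, s < α k ∧ α k < β k ∧ β k ≤ e) (h2 : ∀ k l, k < l → β k < α l)
    (hα : ∀ k, ((c (α k)).proc p).pc = .writingA)
    (hβ : ∀ k, ((c (β k)).proc p).pc = .writingB) : Churn c p s e 0 := by
  have hαβ : ∀ k, verA c p (α k) < verA c p (β k) := fun k =>
    hc.verA_lt (h1 k).2.1.le (hα k) (by simp [hβ])
  -- Each scan accounts for a new version: the write of `R_a` met at `α m` ends before `β m`, and
  -- the write of `R_b` met there ends before `α (m + 1)`.
  have key : ∀ m, ∀ hm : m < φ,
      verB c p (α ⟨0, hφ⟩) + m + 1 ≤ verA c p (β ⟨m, hm⟩) := by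
    intro m
    induction m with
    | zero =>
      intro hm
      have h3 := hαβ ⟨0, hφ⟩
      have h4 := verB_le_verA (c := c) (p := p) (α ⟨0, hφ⟩)
      omega
    | succ m ih =>
      intro hm
      have h3 := ih (by omega)
      have h4 := hc.verB_lt (p := p) (h2 ⟨m, by omega⟩ ⟨m + 1, hm⟩ (by simp)).le (hβ _)
        (by simp [hα])
      have h5 := hαβ ⟨m + 1, hm⟩
      have h6 := verB_le_verA (c := c) (p := p) (α ⟨m + 1, hm⟩)
      have h7 := verA_le (c := c) (p := p) (β ⟨m, by omega⟩)
      omega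
  refine ⟨α ⟨0, hφ⟩, β ⟨φ - 1, by omega⟩, (h1 _).1, (h1 _).2.2, ?_⟩
  have := key (φ - 1) (by omega)
  omega

/-- An `ARead` with response `v` either meets many writes, or once reads `v` undisturbed. -/
theorem IsARead.churn_or_clean (hc : IsExecution c) (hφ : 0 < φ) {s e : ℕ} {v : Fin K}
    (hr : IsARead c p s e (some v)) :
    Churn c (prev p) s e 0 ∨ ∃ m, Clean c (prev p) s e m v := by
  obtain ⟨α, β, h1, h2, hα, hβ⟩ := hr.observations hc
  by_cases hw : (∀ k, ((c (α k)).proc (prev p)).pc = .writingA) ∧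
      ∀ k, ((c (β k)).proc (prev p)).pc = .writingB
  · exact Or.inl (churn_of_forall_writing hc hφ α β h1 h2 hw.1 hw.2)
  · right
    rw [not_and_or, not_forall, not_forall] at hw
    rcases hw with ⟨k, hk⟩ | ⟨k, hk⟩
    · exact ⟨_, α k, β k, (h1 k).1, by have := h1 k; omega, by have := h1 k; omega, (h1 k).2.2,
        Or.inl ⟨(h1 k).2.1.le, hk, (hα k).resolve_left hk, rfl, hβ k⟩⟩
    · exact ⟨_, β k, α k, by have := h1 k; omega, (h1 k).2.2, (h1 k).1, by have := h1 k; omega,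
        Or.inr ⟨(h1 k).2.1.le, hk, (hβ k).resolve_left hk, rfl, hα k⟩⟩

/-- Undisturbed reads of different values in successive `ARead`s see increasing versions. -/
theorem Clean.lt (hc : IsExecution c) {s e s' e' m m' : ℕ} {v v' : Fin K}
    (h : Clean c p s e m v) (h' : Clean c p s' e' m' v') (hes : e ≤ s') (hv : v ≠ v') :
    m < m' := by
  obtain ⟨τ, σ, h1, h2, h3, h4, h⟩ := h
  obtain ⟨τ', σ', h1', h2', h3', h4', h'⟩ := h'
  by_contra! hle
  have hA := hc.verA_mono (p := p) (show τ ≤ τ' by omega)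
  have hB := verB_mono (c := c) (p := p) (show τ ≤ τ' by omega)
  rcases h with ⟨hs, hw, rfl, rfl, ho⟩ | ⟨hs, hw, rfl, rfl, ho⟩ <;>
    rcases h' with ⟨-, hw', rfl, rfl, -⟩ | ⟨-, hw', rfl, rfl, -⟩
  · exact hv (hc.regA_eq (by omega))
  · have hBσ := verB_mono (c := c) (p := p) hs
    have hBσ' := verB_mono (c := c) (p := p) (show σ ≤ τ' by omega)
    have hle' := verA_le (c := c) (p := p) τ
    -- Outside this case `R_b` has the same version at `τ` and `τ'`: either the second read is older
    -- than the first, or both are in the arbitrary version 0. The companion read of `R_b` at `σ`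
    -- then rules out a value other than `v` at `τ'`.
    by_cases heq : verA c p τ = verB c p τ' ∧ 1 ≤ verB c p τ'
    · exact hv (hc.regA_eq_regB heq.1 heq.2)
    · rcases ho with ho | ho
      · have := hc.verB_lt (show σ ≤ τ' by omega) ho hw'
        omega
      · exact hv (ho ▸ hc.regB_eq (by omega))
  · have hle' := verB_le_verA (c := c) (p := p) τ'
    -- In version 0 the two registers may differ; the companion read of `R_a` replaces their
    -- equality.
    by_cases h1 : 1 ≤ verB c p τ
    · exact hv (hc.regA_eq_regB (t := τ') (t' := τ) (by omega) h1).symm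
    · rcases ho with ho | ho
      · have := hc.verA_lt (show σ ≤ τ' by omega) ho hw'
        omega
      · have := hc.verA_mono (p := p) (show σ ≤ τ' by omega)
        exact hv (ho ▸ hc.regA_eq (by omega))
  · exact hv (hc.regB_eq (by omega))

/-! ### Propagation around the ring -/

/-- The passes of the loop of a processor that change its registers are caused by those of the previous
processor. -/
theorem Churn.prev (hc : IsExecution c) {s e d : ℕ} (hd : 2 * d + 3 ≤ φ) (h : Churn c p s e d) :
    Churn c (prev p) s e (d + 1) := by
  obtain ⟨t, t', hst, hte, hver⟩ := h
  -- The versions strictly between `verB c p t` and `verA c p t'` number at least `φ - 1 - 2 * d`.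
  have hex : ∀ k : Fin (φ - 1 - 2 * d), ∃ T ≤ t', verB c p T = verB c p t + 1 + k.val ∧
      ((c T).proc p).pc.AfterA ∧ Replaces c p T ((c T).regA p) ((c T).regB p) := fun k =>
    hc.exists_replaces (t₀ := t) (by omega) (by have := k.2; omega)
  choose T hT hTv hTw S E V hS hE hr hne hV hV0 using hex
  -- The `ARead` is invoked in a version of `R_b` later than that of `t`, hence after `t`.
  have hlate : ∀ k, s < S k := fun k => by
    by_contra! hle
    have := verB_mono (c := c) (p := p) (show S k ≤ t by omega)
    rw [hS, hTv] at this
    omega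
  by_cases hch : ∃ k, Churn c (TwoReg.prev p) (S k) (E k) 0
  · obtain ⟨k, hk⟩ := hch
    exact hk.mono (hlate k).le (by have := hE k; have := hT k; omega) (by omega)
  · have hclean := fun k => ((hr k).churn_or_clean hc (by omega)).resolve_left
      fun h => hch ⟨k, h⟩
    choose M hM using hclean
    have hstep : ∀ k l, k.val + 1 = l.val → M k < M l := fun k l hkl => by
      refine (hM k).lt hc (hM l) ?_ ?_
      · by_contra! hle
        have := verB_mono (c := c) (p := p) (show S l ≤ T k by have := hE k; omega)
        rw [hS, hTv, hTv] at this
        omega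
      -- The new value of pass `k` is the old value of pass `l`. Processor 0 reads the old value and
      -- the others read the new one; either way the two responses differ.
      · have hreg : (c (T k)).regA p = (c (T l)).regB p := by
          refine hc.regA_eq_regB ?_ ?_
          · rw [verA_of_afterA (hTw k), hTv, hTv]; omega
          · rw [hTv]; omega
        by_cases hp : p = 0
        · rw [hV0 k hp, hV0 l hp, ← hreg]; exact (hne k).symm
        · rw [hV k hp, hV l hp, hreg]; exact (hne l).symm
    have hsum : ∀ m, ∀ hm : m < φ - 1 - 2 * d, M ⟨0, by omega⟩ + m ≤ M ⟨m, hm⟩ := by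
      intro m
      induction m with
      | zero => intro _; exact le_rfl
      | succ m ih =>
        intro hm
        have h1 := ih (by omega)
        have h2 := hstep ⟨m, by omega⟩ ⟨m + 1, hm⟩ rfl
        omega
    obtain ⟨τ, h1, -, h3, -⟩ := (hM ⟨0, by omega⟩).exists_time
    obtain ⟨τ', -, h2', -, h4'⟩ := (hM ⟨φ - 1 - 2 * d - 1, by omega⟩).exists_time
    have hlast := hsum (φ - 1 - 2 * d - 1) (by omega)
    -- The `φ - 1 - 2 * d` clean versions span at least `φ - 2 * (d + 1)` increments, whence the new
    -- loss.
    refine ⟨τ, τ', (hlate _).trans h1, ?_, ?_⟩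
    · have := hE ⟨φ - 1 - 2 * d - 1, by omega⟩
      have := hT ⟨φ - 1 - 2 * d - 1, by omega⟩
      omega
    · omega

theorem iterate_prev (m : ℕ) (i : Fin n) : prev^[m] i = i - m • (1 : Fin n) := by
  induction m with
  | zero => simp
  | succ m ih => rw [Function.iterate_succ_apply', ih, prev, succ_nsmul, sub_sub]

theorem iterate_prev_card (i : Fin n) : prev^[n] i = i := by
  have : n • (1 : Fin n) = 0 := by simpa using card_nsmul_eq_zero (x := (1 : Fin n))
  rw [iterate_prev, this, sub_zero]

/-- A processor writes nothing while it executes `ARead`. -/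
theorem IsARead.not_churn (hc : IsExecution c) {s e d : ℕ} {r : Option (Fin K)}
    (hr : IsARead c p s e r) (hd : 2 * d < φ) : ¬ Churn c p s e d := by
  rintro ⟨t, t', h1, h2, h3⟩
  have hconst : ∀ u, s < u → u ≤ e → verB c p u = verB c p (s + 1) := by
    intro u hu
    induction u, hu using Nat.le_induction with
    | base => intro _; rfl
    | succ u hu ih =>
      intro hue
      have h4 := hr.inside u hu (by omega)
      rcases hc.ver_step (p := p) u with h | h | h
      · simp [h.1, PC.InARead] at h4
      · simp [h.1, PC.InARead] at h4
      · rw [h.2.1, ih (by omega)]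
  -- `Churn` does not itself place `t'` after `s`; the version inequality does.
  have hlt : s < t' := by
    by_contra! hle
    have := hc.verA_mono (p := p) (show t' ≤ s + 1 by omega)
    have := verB_mono (c := c) (p := p) (show s + 1 ≤ t by omega)
    have := hr.inside (s + 1) (by omega) hr.lt
    have := verA_of_not_afterA (c := c) (p := p) (t := s + 1)
      (by rcases this with h | h | h | h | h <;> simp [h, PC.AfterA])
    omega
  have h5 := verA_of_not_afterA (c := c) (p := p) (t := t')
    (by rcases hr.inside t' hlt h2 with h | h | h | h | h <;> simp [h, PC.AfterA])
  have h6 := hconst t' hlt h2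
  have h7 := verB_mono (c := c) (p := p) (show s + 1 ≤ t by omega)
  omega

theorem IsARead.not_contaminated (hφ : 2 * n < φ) (hc : IsExecution c) {s e : ℕ}
    {r : Option (Fin K)} (hr : IsARead c p s e r) : ¬ Contaminated c p s e r := by
  rintro ⟨v, rfl, hcont⟩
  -- A clean read would exhibit `v` as the content of an input register during the `ARead`.
  have hchurn : Churn c (TwoReg.prev p) s e 0 := by
    refine (hr.churn_or_clean hc (by omega)).resolve_right ?_
    rintro ⟨m, τ, σ, h1, h2, -, -, h | h⟩
    · exact (hcont τ h1 h2).1 h.2.2.1.symm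
    · exact (hcont τ h1 h2).2.1 h.2.2.1.symm
  have key : ∀ d < n, Churn c (TwoReg.prev^[d + 1] p) s e d := by
    intro d
    induction d with
    | zero => intro _; exact hchurn
    | succ d ih =>
      intro hd
      rw [Function.iterate_succ_apply']
      exact (ih (by omega)).prev hc (by omega)
  have hn := NeZero.pos n
  have h := key (n - 1) (by omega)
  rw [Nat.sub_add_cancel hn, iterate_prev_card] at h
  exact hr.not_churn hc (by omega) h

end TwoReg

theorem mainTheorem6 (n φ K : ℕ) [NeZero n] (hφ : 2 * n < φ)
    (c : ℕ → TwoReg.Config n φ K) (hc : TwoReg.IsExecution c)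
    (i : Fin n) (s e : ℕ) (r : Option (Fin K)) (hr : TwoReg.IsARead c i s e r) :
    ¬ TwoReg.Contaminated c i s e r :=
  hr.not_contaminated hφ hc
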